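/- Let $T$ be a standard Borel space, $P$ a Polish space, and $\Lambda$ a Borel measure on $T$ (with values in $[0,\infty]$, not necessarily $\sigma$-finite). Fix a Polish topology on $T$ that generates its Borel $\sigma$-algebra $\mathcal B$ (for instance the one transported by a Borel isomorphism from $[0,1]$, $\mathbb Z$ or a finite set), give $T\times P$ the product topology, and let $\mathcal B^*$ be its Borel $\sigma$-algebra and $\pi:T\times P\to T$ the projection. Let $$\mathcal B_\Lambda=\{Z\subset T : \exists\, A,C\in\mathcal B,\ A\subset Z\subset C,\ \Lambda(C\setminus A)=0\}$$ be the completion of $\mathcal B$ with respect to $\Lambda$, and $$\pi(\mathcal B^*,\mathcal B_\Lambda)=\{B\in\mathcal B^* : \pi(B\cap U)\in\mathcal B_\Lambda \text{ for every open } U\subset T\times P\}.$$ Define $\widetilde\Lambda:\mathcal B^*\to[0,\infty]$ by $$\widetilde\Lambda(B)=\int_T \#\bigl(B\cap(\{t\}\times P)\bigr)\,d\Lambda(t)\quad\text{if } B\in\pi(\mathcal B^*,\mathcal B_\Lambda),\qquad \widetilde\Lambda(B)=\infty\quad\text{otherwise},$$ where $\#$ takes the value $\infty$ on all infinite sets.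 Then the integrand is $\mathcal B_\Lambda$-measurable for every $B\in\pi(\mathcal B^*,\mathcal B_\Lambda)$, and $\widetilde\Lambda$ is a (countably additive) measure on $(T\times P,\mathcal B^*)$. Moreover $\widetilde\Lambda$ extends $\Lambda$, that is: 1. $\widetilde\Lambda(A\times\{p\})=\Lambda(A)$ for all $A\in\mathcal B$ and $p\in P$; 2. on generalized transversals (the sets $B\in\mathcal B^*$ for which $B\cap(\{t\}\times P)$ is countable for every $t\in T$), $\widetilde\Lambda$ is the transverse invariant measure induced by $\Lambda$. Here a transverse invariant measure is a countably additive $[0,\infty]$-valued function on generalized transversals, vanishing on $\emptyset$, that takes equal values on $B$ and $B'$ whenever there is a measurable isomorphism $B\to B'$ mapping each point of $B$ to a point with the same first coordinate. The claim is that the restriction of $\widetilde\Lambda$ is a transverse invariant measure, and that it agrees on all generalized transversals with every transverse invariant measure $\nu$ satisfying $\nu(A\times\{p\})=\Lambda(A)$ for all $A\in\mathcal B$, $p\in P$. -/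

import Mathlib

open MeasureTheory Set
open scoped ENNReal

/-- The class `π(𝓑*, 𝓑_Λ)`: Borel sets `B` of `T × P` such that the projection to `T` of `B ∩ U` is
`Λ`-measurable (measurable for the completion of the Borel σ-algebra of `T` with respect to `Λ`)
for every open `U`. -/
def projClass {T P : Type*} [TopologicalSpace T] [MeasurableSpace T]
    [TopologicalSpace P] [MeasurableSpace P] (Λ : Measure T) : Set (Set (T × P)) :=
  {B | MeasurableSet B ∧
    ∀ U : Set (T × P), IsOpen U → NullMeasurableSet (Prod.fst '' (B ∩ U)) Λ}

/-- `NullMeasurableSet` is membership in the completion `𝓑_Λ`: a set squeezed between two Borel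
sets whose difference is `Λ`-null. -/
theorem nullMeasurableSet_iff_squeezed {T : Type*} [MeasurableSpace T] (Λ : Measure T)
    (Z : Set T) :
    NullMeasurableSet Z Λ ↔
      ∃ A B : Set T, MeasurableSet A ∧ MeasurableSet B ∧ A ⊆ Z ∧ Z ⊆ B ∧ Λ (B \ A) = 0 := by
  constructor
  · intro h
    obtain ⟨A, hAZ, hA, hAe⟩ := h.exists_measurable_subset_ae_eq
    obtain ⟨B, hZB, hB, hBe⟩ := h.exists_measurable_superset_ae_eq
    exact ⟨A, B, hA, hB, hAZ, hZB, (ae_le_set.1 (hBe.trans hAe.symm).le)⟩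
  · rintro ⟨A, B, hA, hB, hAZ, hZB, h⟩
    refine NullMeasurableSet.congr hA.nullMeasurableSet ?_
    exact Filter.EventuallyLE.antisymm hAZ.eventuallyLE
      (ae_le_set.2 (measure_mono_null (sdiff_subset_sdiff_left hZB) h))

/-- The number `#(B ∩ ({t} × P))` of points of `B` on the plaque over `t`, `∞` if there are
infinitely many. -/
noncomputable def plaqueCount {T P : Type*} (B : Set (T × P)) (t : T) : ℝ≥0∞ :=
  ((B ∩ ({t} ×ˢ univ)).encard : ℝ≥0∞)

open Classical in
/-- The set function `Λ̃`: the integral of the number of points on the plaques for sets in the class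
`π(𝓑*, 𝓑_Λ)`, and `∞` for all other sets. -/
noncomputable def extendedMeasure {T P : Type*} [TopologicalSpace T] [MeasurableSpace T]
    [TopologicalSpace P] [MeasurableSpace P] (Λ : Measure T) (B : Set (T × P)) : ℝ≥0∞ :=
  if B ∈ projClass (P := P) Λ then ∫⁻ t, plaqueCount B t ∂Λ else ∞

/-- A generalized transversal of `T × P`: a Borel set meeting each leaf `{t} × P` in a countable
set. -/
def IsGeneralizedTransversal {T P : Type*} [MeasurableSpace T] [MeasurableSpace P]
    (B : Set (T × P)) : Prop :=
  MeasurableSet B ∧ ∀ t : T, (B ∩ ({t} ×ˢ univ)).Countable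

/-- `ν` (which matters only on generalized transversals) is a transverse invariant measure on
`T × P`: it is countably additive, and invariant under measurable holonomy transformations, i.e.
measurable isomorphisms between generalized transversals which map each point to a point of the
same leaf. -/
structure IsTransverseInvariantMeasure {T P : Type*} [MeasurableSpace T] [MeasurableSpace P]
    (ν : Set (T × P) → ℝ≥0∞) : Prop where
  empty : ν ∅ = 0
  iUnion : ∀ B : ℕ → Set (T × P), (∀ n, IsGeneralizedTransversal (B n)) →
    Pairwise (fun m n => Disjoint (B m) (B n)) → ν (⋃ n, B n) = ∑' n, ν (B n)
  holonomy : ∀ B B' : Set (T × P), IsGeneralizedTransversal B → IsGeneralizedTransversal B' →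
    ∀ γ : B ≃ᵐ B', (∀ x : B, (γ x : T × P).1 = (x : T × P).1) → ν B = ν B'

/-! The engine is the Lusin–Novikov theorem: a Borel map with countable fibres is injective on each
piece of a countable Borel partition. It cuts a generalized transversal into Borel partial graphs
over `T`, and each of these slides along the leaves onto a horizontal set `A ×ˢ {p}`; hence a
transverse invariant measure is determined by its horizontal values. As injective Borel images are
Borel, Borel subsets of a transversal also have Borel projections, so every transversal lies in
`projClass Λ`.

On that class the plaque count is a countable supremum of finite sums of indicators of projections
of `B ∩ U` with `U` basic open. It is therefore a.e. measurable, and additivity is monotone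
convergence. It remains to exclude a Borel set outside the class (value `∞`) sitting in a set of
finite value. If the integral for `B` is finite, almost every plaque carries finitely many points of
`B`, so off a null set of plaques `B` is a transversal, and all its Borel subsets lie in the class.
No σ-finiteness enters.

For Lusin–Novikov itself, discard from the domain a set covered by countably many Borel injectivity
sets, chosen so that what remains is minimal with respect to finite families of basic open sets
meeting a common fibre. If anything remains, it drives a Cantor scheme whose limit points fill out a
perfect set inside one fibre, which is then uncountable. -/

section LusinNovikov

open Filter Topology

/-! ### Separation of analytic sets -/

theorem MeasureTheory.AnalyticSet.inter {α : Type*} [TopologicalSpace α] [T2Space α] {s t : Set α}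
    (hs : AnalyticSet s) (ht : AnalyticSet t) : AnalyticSet (s ∩ t) := by
  rw [inter_eq_iInter]
  exact AnalyticSet.iInter (by simp [hs, ht])

/-- The points `z` for which the fibre of `g` through `z` contains another point, lying in a given
analytic set, form an analytic set. -/
theorem analyticSet_setOf_exists_ne {Z X : Type*} [TopologicalSpace Z] [PolishSpace Z]
    [TopologicalSpace X] [T2Space X] {g : Z → X} (hg : Continuous g) {A : Set Z}
    (hA : AnalyticSet A) : AnalyticSet {z | ∃ w ∈ A, w ≠ z ∧ g w = g z} := by
  borelize Z
  have h1 : MeasurableSet {p : Z × Z | p.2 ≠ p.1 ∧ g p.2 = g p.1} :=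
    ((isOpen_ne_fun continuous_snd continuous_fst).measurableSet).inter
      (isClosed_eq (hg.comp continuous_snd) (hg.comp continuous_fst)).measurableSet
  have h2 := (h1.analyticSet.inter (hA.preimage continuous_snd)).image_of_continuous
    (continuous_fst (X := Z) (Y := Z))
  convert h2 using 1
  ext z
  simp only [mem_ofPred_eq, mem_image, mem_inter_iff, mem_preimage, Prod.exists, exists_and_right,
    exists_eq_right]
  exact exists_congr fun w => by tauto

/-- An analytic set on which a continuous map is injective is contained in a Borel set on which
the map is injective. -/
theorem MeasureTheory.AnalyticSet.exists_measurableSet_injOn {Z X : Type*} [TopologicalSpace Z]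
    [PolishSpace Z] [MeasurableSpace Z] [BorelSpace Z] [TopologicalSpace X] [T2Space X] {g : Z → X}
    (hg : Continuous g) {A : Set Z} (hA : AnalyticSet A) (hinj : InjOn g A) :
    ∃ D, A ⊆ D ∧ MeasurableSet D ∧ InjOn g D := by
  -- Two separations: no point of `C` shares its fibre with a different point of `A`, which keeps
  -- `A` disjoint from the points sharing a fibre with a different point of `C`; `D` avoids the
  -- latter.
  obtain ⟨C, hAC, hdC, hC⟩ := hA.measurablySeparable (analyticSet_setOf_exists_ne hg hA) (by
    rw [disjoint_left]
    rintro z hz ⟨w, hw, hne, heq⟩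
    exact hne (hinj hw hz heq))
  obtain ⟨D, hAD, hdD, hD⟩ := hA.measurablySeparable (analyticSet_setOf_exists_ne hg hC.analyticSet)
    (by
      rw [disjoint_left]
      rintro z hz ⟨w, hw, hne, heq⟩
      exact disjoint_left.1 hdC ⟨z, hz, hne.symm, heq.symm⟩ hw)
  refine ⟨C ∩ D, subset_inter hAC hAD, hC.inter hD, ?_⟩
  intro z hz w hw heq
  by_contra hne
  exact disjoint_left.1 hdD ⟨z, hz.1, hne, heq⟩ hw.2

/-! ### Countable injectivity and the minimal remainder -/

/-- `A` is covered by countably many Borel sets on which `g` is injective. -/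
def CountablyInjOn {Z X : Type*} [MeasurableSpace Z] (g : Z → X) (A : Set Z) : Prop :=
  ∃ 𝒟 : Set (Set Z), 𝒟.Countable ∧ (∀ D ∈ 𝒟, MeasurableSet D ∧ InjOn g D) ∧ A ⊆ ⋃₀ 𝒟

namespace CountablyInjOn

variable {Z X : Type*} [MeasurableSpace Z] {g : Z → X}

theorem mono {A A' : Set Z} (h : CountablyInjOn g A) (hA : A' ⊆ A) : CountablyInjOn g A' := by
  obtain ⟨𝒟, h1, h2, h3⟩ := h
  exact ⟨𝒟, h1, h2, hA.trans h3⟩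

theorem empty : CountablyInjOn g ∅ := ⟨∅, by simp, by simp, by simp⟩

theorem of_injOn {D : Set Z} (hD : MeasurableSet D) (h : InjOn g D) : CountablyInjOn g D :=
  ⟨{D}, countable_singleton D, by simp [hD, h], by simp⟩

theorem iUnion {ι : Type*} [Countable ι] {A : ι → Set Z} (h : ∀ i, CountablyInjOn g (A i)) :
    CountablyInjOn g (⋃ i, A i) := by
  choose 𝒟 h1 h2 h3 using h
  refine ⟨⋃ i, 𝒟 i, countable_iUnion h1, ?_, ?_⟩
  · rintro D hD
    obtain ⟨i, hi⟩ := mem_iUnion.1 hD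
    exact h2 i D hi
  · refine iUnion_subset fun i => (h3 i).trans (sUnion_subset_sUnion (subset_iUnion 𝒟 i))

theorem union {A A' : Set Z} (h : CountablyInjOn g A) (h' : CountablyInjOn g A') :
    CountablyInjOn g (A ∪ A') := by
  rw [union_eq_iUnion]
  exact iUnion (by simp [h, h'])

end CountablyInjOn

/-- Some fibre of `g` meets each of the sets `b i ∩ B` for `i ∈ F`. -/
def MeetsCommonFibre {Z X ι : Type*} (g : Z → X) (b : ι → Set Z) (F : Finset ι) (B : Set Z) : Prop :=
  ∃ x, ∀ i ∈ F, ∃ z ∈ b i ∩ B, g z = x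

/-- Borel sets with countably injective complement are stable under countable intersection, and
there are only countably many `F`. For each `F`, pick one that fails to meet a common fibre if any
does, and intersect the choices. -/
theorem exists_minimal_compl_countablyInjOn {Z X ι : Type*} [MeasurableSpace Z] [Countable ι]
    (g : Z → X) (b : ι → Set Z) :
    ∃ S : Set Z, MeasurableSet S ∧ CountablyInjOn g Sᶜ ∧
      ∀ B : Set Z, MeasurableSet B → CountablyInjOn g Bᶜ →
        ∀ F, MeetsCommonFibre g b F S → MeetsCommonFibre g b F B := by
  have h : ∀ F : Finset ι, ∃ S : Set Z, MeasurableSet S ∧ CountablyInjOn g Sᶜ ∧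
      ∀ B : Set Z, MeasurableSet B → CountablyInjOn g Bᶜ →
        MeetsCommonFibre g b F S → MeetsCommonFibre g b F B := by
    intro F
    by_cases h : ∃ S : Set Z, MeasurableSet S ∧ CountablyInjOn g Sᶜ ∧ ¬ MeetsCommonFibre g b F S
    · obtain ⟨S, h1, h2, h3⟩ := h
      exact ⟨S, h1, h2, fun _ _ _ h => (h3 h).elim⟩
    · push Not at h
      exact ⟨univ, .univ, by simpa using CountablyInjOn.empty, fun B hB hB' _ => h B hB hB'⟩
  choose S h1 h2 h3 using h
  refine ⟨⋂ F, S F, .iInter h1, by rw [compl_iInter]; exact .iUnion h2, ?_⟩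
  rintro B hB hB' F ⟨x, hx⟩
  refine h3 F B hB hB' ⟨x, fun i hi => ?_⟩
  obtain ⟨z, hz, hzx⟩ := hx i hi
  exact ⟨z, ⟨hz.1, mem_iInter.1 hz.2 F⟩, hzx⟩

/-- In a set `S` with the minimality property, a finite family of open sets meeting a common
fibre meets a common fibre in such a way that a prescribed member contains two of its points. -/
theorem exists_common_fibre_two_points {Z X ι : Type*} [TopologicalSpace Z] [PolishSpace Z]
    [MeasurableSpace Z] [BorelSpace Z] [TopologicalSpace X] [T2Space X] {g : Z → X}
    (hg : Continuous g) {b : ι → Set Z} (hb : ∀ i, IsOpen (b i)) {S : Set Z}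
    (hS : MeasurableSet S) (hSc : CountablyInjOn g Sᶜ)
    (hmin : ∀ B : Set Z, MeasurableSet B → CountablyInjOn g Bᶜ →
        ∀ F, MeetsCommonFibre g b F S → MeetsCommonFibre g b F B)
    {F : Finset ι} (hF : MeetsCommonFibre g b F S) {i : ι} (hi : i ∈ F) :
    ∃ x, (∀ j ∈ F, ∃ z ∈ b j ∩ S, g z = x) ∧
      ∃ z ∈ b i ∩ S, ∃ w ∈ b i ∩ S, z ≠ w ∧ g z = x ∧ g w = x := by
  by_contra hcon
  push Not at hcon
  have : Nonempty F := ⟨⟨i, hi⟩⟩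
  -- The points of `b i ∩ S` whose fibre meets every `b j ∩ S`. If the claim fails, `g` is injective
  -- on this analytic set, so a Borel injectivity set `D ⊇ A` can be removed from `S`, against
  -- minimality.
  set A : Set Z := ⋂ j : F, (b i ∩ S) ∩ g ⁻¹' (g '' (b j ∩ S)) with hA
  have mem_A : ∀ z, z ∈ A ↔ z ∈ b i ∩ S ∧ ∀ j ∈ F, ∃ w ∈ b j ∩ S, g w = g z := by
    intro z
    simp only [hA, ← inter_iInter, mem_inter_iff, mem_iInter, mem_preimage, mem_image,
      Subtype.forall]
  have hAan : AnalyticSet A := by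
    refine AnalyticSet.iInter fun j => ?_
    exact ((hb i).measurableSet.inter hS).analyticSet.inter
      ((((hb j).measurableSet.inter hS).analyticSet.image_of_continuous hg).preimage hg)
  have hAinj : InjOn g A := by
    intro z hz w hw heq
    by_contra hne
    rw [mem_A] at hz hw
    exact hcon (g z) hz.2 z hz.1 w hw.1 hne rfl heq.symm
  obtain ⟨D, hAD, hD, hDinj⟩ := hAan.exists_measurableSet_injOn hg hAinj
  obtain ⟨x, hx⟩ := hmin (S \ D) (hS.diff hD)
    (by
      rw [sdiff_eq, compl_inter, compl_compl]
      exact hSc.union (.of_injOn hD hDinj)) F hF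
  obtain ⟨z, hz, rfl⟩ := hx i hi
  refine hz.2.2 (hAD ((mem_A z).2 ⟨⟨hz.1, hz.2.1⟩, fun j hj => ?_⟩))
  obtain ⟨w, hw, hwz⟩ := hx j hj
  exact ⟨w, ⟨hw.1, hw.2.1⟩, hwz⟩

/-! ### A Cantor scheme inside one fibre -/

open Classical in
/-- Refine finitely many basic open sets meeting a common fibre, splitting the one with index `i`
into two disjoint ones. -/
theorem exists_split_refinement {Z X ι : Type*} [MetricSpace Z] {g : Z → X} {b : ι → Set Z}
    (hb : TopologicalSpace.IsTopologicalBasis (range b)) {S : Set Z}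
    (hsplit : ∀ F : Finset ι, MeetsCommonFibre g b F S → ∀ i ∈ F,
      ∃ x, (∀ j ∈ F, ∃ z ∈ b j ∩ S, g z = x) ∧
        ∃ z ∈ b i ∩ S, ∃ w ∈ b i ∩ S, z ≠ w ∧ g z = x ∧ g w = x)
    {n : ℕ} {U : ℕ → ι} (hU : MeetsCommonFibre g b ((Finset.range (n + 1)).image U) S)
    {i : ℕ} (hi : i ≤ n) {ε : ℝ} (hε : 0 < ε) :
    ∃ U' : ℕ → ι, MeetsCommonFibre g b ((Finset.range (n + 2)).image U') S ∧
      (∀ j ≤ n, closure (b (U' j)) ⊆ b (U j)) ∧ b (U' (n + 1)) ⊆ b (U i) ∧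
      (∀ j ≤ n + 1, ∀ x ∈ b (U' j), ∀ y ∈ b (U' j), dist x y ≤ ε) ∧
      Disjoint (b (U' (n + 1))) (b (U' i)) := by
  obtain ⟨x, hx, z, hz, w, hw, hne, hzx, hwx⟩ := hsplit _ hU (U i)
    (Finset.mem_image_of_mem U (Finset.mem_range.2 (by omega)))
  obtain ⟨V, W, hV, hW, hzV, hwW, hVW⟩ := t2_separation hne
  -- `s k` is the parent of the new set with index `k`. Only the two children of `i`, with indices
  -- `i` and `n + 1`, are confined to the disjoint neighbourhoods `V` and `W`.
  set s : ℕ → ℕ := fun k => if k = n + 1 then i else k with hs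
  set O : ℕ → Set Z := fun k => if k = n + 1 then W else if k = i then V else univ with hO
  have key : ∀ k ≤ n + 1, ∃ y ∈ b (U (s k)) ∩ S, g y = x ∧ y ∈ O k := by
    intro k hk
    rcases eq_or_ne k (n + 1) with rfl | hk1
    · exact ⟨w, by simpa [hs] using hw, hwx, by simpa [hO] using hwW⟩
    rcases eq_or_ne k i with rfl | hki
    · exact ⟨z, by simpa [hs, hk1] using hz, hzx, by simpa [hO, hk1] using hzV⟩
    · obtain ⟨y, hy, hyx⟩ := hx (U k) (Finset.mem_image_of_mem U (Finset.mem_range.2 (by omega)))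
      exact ⟨y, by simpa [hs, hk1] using hy, hyx, by simp [hO, hk1, hki]⟩
  have hOo : ∀ k, IsOpen (O k) := by
    intro k
    simp only [hO]
    split_ifs
    exacts [hW, hV, isOpen_univ]
  have key2 : ∀ k, ∃ c : ι, k ≤ n + 1 → (∃ y ∈ b c ∩ S, g y = x) ∧ closure (b c) ⊆ b (U (s k)) ∧
      b c ⊆ O k ∧ ∀ p ∈ b c, ∀ q ∈ b c, dist p q ≤ ε := by
    intro k
    by_cases hk : k ≤ n + 1
    swap
    · exact ⟨U 0, fun h => (hk h).elim⟩
    obtain ⟨y, hy, hyx, hyO⟩ := key k hk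
    have hopen : IsOpen (b (U (s k)) ∩ O k ∩ Metric.ball y (ε / 2)) :=
      ((hb.isOpen (mem_range_self _)).inter (hOo k)).inter Metric.isOpen_ball
    obtain ⟨_, ⟨c, rfl⟩, hyc, hc⟩ := hb.exists_closure_subset (hopen.mem_nhds
      ⟨⟨hy.1, hyO⟩, Metric.mem_ball_self (by positivity)⟩)
    refine ⟨c, fun _ => ⟨⟨y, ⟨hyc, hy.2⟩, hyx⟩, fun p hp => (hc hp).1.1,
      fun p hp => (hc (subset_closure hp)).1.2, fun p hp q hq => ?_⟩⟩
    have h1 := Metric.mem_ball.1 (hc (subset_closure hp)).2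
    have h2 := Metric.mem_ball.1 (hc (subset_closure hq)).2
    linarith [dist_triangle_right p q y]
  choose U' hU' using key2
  refine ⟨U', ⟨x, fun c hc => ?_⟩, fun j hj => ?_, ?_, fun j hj => (hU' j hj).2.2.2, ?_⟩
  · obtain ⟨k, hk, rfl⟩ := Finset.mem_image.1 hc
    exact (hU' k (by have := Finset.mem_range.1 hk; omega)).1
  · have := (hU' j (by omega)).2.1
    rwa [show s j = j by simp only [hs]; rw [if_neg (by omega)]] at this
  · have := subset_closure.trans (hU' (n + 1) le_rfl).2.1
    rwa [show s (n + 1) = i by simp [hs]] at this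
  · have h1 := (hU' (n + 1) le_rfl).2.2.1
    have h2 := (hU' i (by omega)).2.2.1
    simp only [hO, if_true] at h1
    simp only [hO, if_true, show ¬ i = n + 1 by omega, if_false] at h2
    exact (hVW.mono h2 h1).symm

/-- If finite families of basic open sets meeting a common fibre in `S` can always be split, some
fibre is uncountable. -/
theorem exists_not_countable_fibre {Z X ι : Type*} [MetricSpace Z] [CompleteSpace Z]
    [TopologicalSpace X] [T2Space X] {g : Z → X} (hg : Continuous g) {b : ι → Set Z}
    (hb : TopologicalSpace.IsTopologicalBasis (range b)) {S : Set Z} (hS : S.Nonempty)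
    (hsplit : ∀ F : Finset ι, MeetsCommonFibre g b F S → ∀ i ∈ F,
      ∃ x, (∀ j ∈ F, ∃ z ∈ b j ∩ S, g z = x) ∧
        ∃ z ∈ b i ∩ S, ∃ w ∈ b i ∩ S, z ≠ w ∧ g z = x ∧ g w = x) :
    ∃ x, ¬ (g ⁻¹' {x}).Countable := by
  classical
  obtain ⟨z₀, hz₀⟩ := hS
  obtain ⟨_, ⟨c₀, rfl⟩, hc₀, -⟩ := hb.exists_subset_of_mem_open (mem_univ z₀) isOpen_univ
  let ε : ℕ → ℝ := fun n => (1 / 2) ^ n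
  have hε : ∀ n, 0 < ε n := fun n => by positivity
  -- At stage `n` the indices in use are `0, …, n`. The new index `n + 1` branches off `n.unpair.1`,
  -- a sequence taking every value infinitely often, so each set is split again and again.
  have step : ∀ (n : ℕ) (U : {U : ℕ → ι //
      MeetsCommonFibre g b ((Finset.range (n + 1)).image U) S}), ∃ U' : {U : ℕ → ι //
      MeetsCommonFibre g b ((Finset.range (n + 2)).image U) S},
      (∀ j ≤ n, closure (b (U'.1 j)) ⊆ b (U.1 j)) ∧ b (U'.1 (n + 1)) ⊆ b (U.1 n.unpair.1) ∧
      (∀ j ≤ n + 1, ∀ x ∈ b (U'.1 j), ∀ y ∈ b (U'.1 j), dist x y ≤ ε n) ∧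
      Disjoint (b (U'.1 (n + 1))) (b (U'.1 n.unpair.1)) := by
    intro n U
    obtain ⟨U', h, h'⟩ := exists_split_refinement hb hsplit U.2 (Nat.unpair_left_le n) (hε n)
    exact ⟨⟨U', h⟩, h'⟩
  choose next hnext using step
  let U : ∀ n : ℕ, {U : ℕ → ι // MeetsCommonFibre g b ((Finset.range (n + 1)).image U) S} :=
    fun n => Nat.rec ⟨fun _ => c₀, g z₀, fun i hi => by
      obtain ⟨-, -, rfl⟩ := Finset.mem_image.1 hi
      exact ⟨z₀, ⟨hc₀, hz₀⟩, rfl⟩⟩ next n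
  have hclos : ∀ n, ∀ j ≤ n, closure (b ((U (n + 1)).1 j)) ⊆ b ((U n).1 j) :=
    fun n => (hnext n (U n)).1
  have hchild : ∀ n, b ((U (n + 1)).1 (n + 1)) ⊆ b ((U n).1 n.unpair.1) :=
    fun n => (hnext n (U n)).2.1
  have hdiam : ∀ n, ∀ j ≤ n + 1, ∀ x ∈ b ((U (n + 1)).1 j), ∀ y ∈ b ((U (n + 1)).1 j),
      dist x y ≤ ε n := fun n => (hnext n (U n)).2.2.1
  have hdisj : ∀ n, Disjoint (b ((U (n + 1)).1 (n + 1))) (b ((U (n + 1)).1 n.unpair.1)) :=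
    fun n => (hnext n (U n)).2.2.2
  have hanti : ∀ j n m, j ≤ n → n ≤ m → b ((U m).1 j) ⊆ b ((U n).1 j) := by
    intro j n m hj hnm
    induction m, hnm using Nat.le_induction with
    | base => exact Subset.rfl
    | succ m hm ih => exact (subset_closure.trans (hclos m j (hj.trans hm))).trans ih
  have hpt : ∀ n, ∃ y : ℕ → Z, ∃ x, ∀ j ≤ n, y j ∈ b ((U n).1 j) ∧ g (y j) = x := by
    intro n
    obtain ⟨x, hx⟩ := (U n).2
    have : ∀ j, ∃ y, j ≤ n → y ∈ b ((U n).1 j) ∧ g y = x := by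
      intro j
      by_cases hj : j ≤ n
      · obtain ⟨y, hy, hyx⟩ := hx _ (Finset.mem_image_of_mem _ (Finset.mem_range.2
          (Nat.lt_succ_of_le hj)))
        exact ⟨y, fun _ => ⟨hy.1, hyx⟩⟩
      · exact ⟨z₀, fun h => (hj h).elim⟩
    choose y hy using this
    exact ⟨y, x, hy⟩
  choose y x hy using hpt
  have hε0 : Tendsto ε atTop (𝓝 0) :=
    tendsto_pow_atTop_nhds_zero_of_lt_one (by norm_num) (by norm_num)
  have hlim : ∀ j, ∃ z, Tendsto (fun n => y n j) atTop (𝓝 z) := by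
    intro j
    refine cauchySeq_tendsto_of_complete (Metric.cauchySeq_iff'.2 fun δ hδ => ?_)
    obtain ⟨N, hN⟩ := (hε0.eventually (gt_mem_nhds hδ)).exists_forall_of_atTop
    refine ⟨max N j + 1, fun m hm => ?_⟩
    refine lt_of_le_of_lt (hdiam (max N j) j (by omega) _ ?_ _ ?_) (hN (max N j) (le_max_left _ _))
    · exact hanti j (max N j + 1) m (by omega) hm (hy m j (by omega)).1
    · exact (hy (max N j + 1) j (by omega)).1
  choose z hz using hlim
  have hzmem : ∀ n, ∀ j ≤ n, z j ∈ b ((U n).1 j) := by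
    intro n j hj
    refine hclos n j hj (mem_closure_of_tendsto (hz j) ?_)
    filter_upwards [eventually_ge_atTop (n + 1)] with m hm
    exact hanti j _ m (by omega) hm (hy m j (by omega)).1
  -- The stage `n` points `y n j` share a fibre, and continuity passes this to the limits. The
  -- limits may leave `S`, but only their fibre matters.
  have hgz : ∀ j, g (z j) = g (z 0) := by
    intro j
    refine tendsto_nhds_unique (((hg.tendsto _).comp (hz j)).congr' ?_)
      ((hg.tendsto _).comp (hz 0))
    filter_upwards [eventually_ge_atTop j] with m hm
    simp only [Function.comp_apply]
    rw [(hy m j hm).2, (hy m 0 (Nat.zero_le m)).2]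
  have hpre : Preperfect (range z) := by
    rw [preperfect_iff_nhds]
    rintro _ ⟨j, rfl⟩ V hV
    obtain ⟨δ, hδ, hball⟩ := Metric.mem_nhds_iff.1 hV
    obtain ⟨N, hN⟩ := (hε0.eventually (gt_mem_nhds hδ)).exists_forall_of_atTop
    -- A stage that splits `j` and comes late enough. The `+ 1` makes it positive, since the bound
    -- on the sets of stage `n + 1` is `ε n`.
    have hn1 : j ≤ Nat.pair j (N + 1) := Nat.left_le_pair _ _
    have hn2 : N + 1 ≤ Nat.pair j (N + 1) := Nat.right_le_pair _ _
    have hn3 : (Nat.pair j (N + 1)).unpair.1 = j := by simp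
    generalize Nat.pair j (N + 1) = n at hn1 hn2 hn3
    obtain ⟨n, rfl⟩ : ∃ k, n = k + 1 := ⟨n - 1, by omega⟩
    have h1 := hzmem (n + 1 + 1) (n + 1 + 1) le_rfl
    have h2 := hchild (n + 1) h1
    rw [hn3] at h2
    have h3 := hdisj (n + 1)
    rw [hn3] at h3
    refine ⟨z (n + 1 + 1), ⟨hball ?_, mem_range_self _⟩, ?_⟩
    · exact lt_of_le_of_lt (hdiam n j hn1 _ h2 _ (hzmem (n + 1) j hn1)) (hN n (by omega))
    · intro heq
      exact disjoint_left.1 h3 h1 (heq ▸ hzmem (n + 1 + 1) j (by omega))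
  obtain ⟨f, hf, -, hfinj⟩ := hpre.perfect_closure.exists_nat_bool_injection
    (range_nonempty z).closure
  refine ⟨g (z 0), fun hcount => ?_⟩
  have hsub : closure (range z) ⊆ g ⁻¹' {g (z 0)} :=
    closure_minimal (by rintro _ ⟨j, rfl⟩; exact hgz j) (isClosed_singleton.preimage hg)
  have h1 := (hcount.mono (hf.trans hsub)).preimage_of_injOn (f := f) (hfinj.injOn)
  rw [preimage_range, countable_univ_iff] at h1
  obtain ⟨e, he⟩ := exists_injective_nat (ℕ → Bool)
  refine Function.cantor_injective (fun s : Set ℕ => e fun n => decide (n ∈ s)) fun s s' h => ?_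
  ext n
  simpa using congrFun (he h) n

end LusinNovikov

/-- **Lusin–Novikov theorem**: a measurable map with countable fibres between standard Borel spaces
is injective on each member of a countable measurable partition. -/
theorem Measurable.exists_partition_injOn_of_countable_fibres {Z X : Type*} [MeasurableSpace Z]
    [StandardBorelSpace Z] [MeasurableSpace X] [StandardBorelSpace X] {g : Z → X}
    (hg : Measurable g) (hfib : ∀ x, (g ⁻¹' {x}).Countable) :
    ∃ D : ℕ → Set Z, (∀ n, MeasurableSet (D n)) ∧ Pairwise (fun m n => Disjoint (D m) (D n)) ∧
      (⋃ n, D n) = univ ∧ ∀ n, InjOn g (D n) := by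
  let := upgradeStandardBorel X
  suffices h : CountablyInjOn g (univ : Set Z) by
    obtain ⟨𝒟, h1, h2, h3⟩ := h
    obtain ⟨E, hE⟩ := (h1.insert ∅).exists_eq_range (insert_nonempty _ _)
    have hE' : ∀ n, MeasurableSet (E n) ∧ InjOn g (E n) := by
      intro n
      have : E n ∈ insert ∅ 𝒟 := hE ▸ mem_range_self n
      rcases this with h | h
      · simp [h]
      · exact h2 _ h
    refine ⟨disjointed E, fun n => .disjointed (fun n => (hE' n).1) n, disjoint_disjointed E, ?_,
      fun n => (hE' n).2.mono (disjointed_le E n)⟩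
    rw [iUnion_disjointed, ← sUnion_range, ← hE, sUnion_insert, empty_union]
    exact univ_subset_iff.1 h3
  let tZ := upgradeStandardBorel Z
  -- A finer Polish topology makes `g` continuous without changing the Borel sets.
  obtain ⟨t', ht', hcont, hpol⟩ := hg.exists_continuous
  have hbor : @BorelSpace Z t' _ := by
    refine @BorelSpace.mk Z t' _ ?_
    rw [borel_eq_borel_of_le hpol tZ.toPolishSpace ht']
    exact BorelSpace.measurable_eq
  clear_value tZ
  have main : ∀ (t : TopologicalSpace Z), @PolishSpace Z t → @BorelSpace Z t _ →
      @Continuous Z X t _ g → CountablyInjOn g (univ : Set Z) := by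
    clear hbor hpol hcont ht' t' tZ
    intro t _ _ hcont
    let := TopologicalSpace.upgradeIsCompletelyMetrizable Z
    let b : TopologicalSpace.countableBasis Z → Set Z := Subtype.val
    have hb : TopologicalSpace.IsTopologicalBasis (range b) := by
      simpa [b] using TopologicalSpace.isBasis_countableBasis Z
    obtain ⟨S, hS, hSc, hmin⟩ := exists_minimal_compl_countablyInjOn g b
    rcases S.eq_empty_or_nonempty with rfl | hne
    · simpa using hSc
    obtain ⟨x, hx⟩ := exists_not_countable_fibre hcont hb hne fun F hF i hi =>
      exists_common_fibre_two_points hcont (fun i => hb.isOpen (mem_range_self i)) hS hSc hmin hF hi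
    exact (hx (hfib x)).elim
  exact main t' hpol hbor hcont

/-! ### Generalized transversals and uniqueness of the invariant measure -/

namespace IsGeneralizedTransversal

variable {T P : Type*} [MeasurableSpace T] [MeasurableSpace P]

theorem mono {B B' : Set (T × P)} (hB : IsGeneralizedTransversal B) (h : B' ⊆ B)
    (hB' : MeasurableSet B') : IsGeneralizedTransversal B' :=
  ⟨hB', fun t => (hB.2 t).mono (inter_subset_inter_left _ h)⟩

theorem iUnion {B : ℕ → Set (T × P)} (hB : ∀ n, IsGeneralizedTransversal (B n)) :
    IsGeneralizedTransversal (⋃ n, B n) :=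
  ⟨.iUnion fun n => (hB n).1, fun t => by
    rw [iUnion_inter]
    exact countable_iUnion fun n => (hB n).2 t⟩

theorem of_injOn_fst {B : Set (T × P)} (hB : MeasurableSet B) (h : InjOn Prod.fst B) :
    IsGeneralizedTransversal B := by
  refine ⟨hB, fun t => Set.Subsingleton.countable fun x hx y hy => h hx.1 hy.1 ?_⟩
  rw [show x.1 = t from hx.2.1, show y.1 = t from hy.2.1]

theorem prod_singleton [MeasurableSingletonClass P] {A : Set T} (hA : MeasurableSet A) (p : P) :
    IsGeneralizedTransversal (A ×ˢ {p}) := by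
  refine of_injOn_fst (hA.prod (measurableSet_singleton p)) ?_
  rintro ⟨t, q⟩ ⟨-, hq⟩ ⟨t', q'⟩ ⟨-, hq'⟩ h
  obtain rfl : q = p := hq
  obtain rfl : q' = q := hq'
  obtain rfl : t = t' := h
  rfl

variable [StandardBorelSpace T] [StandardBorelSpace P]

/-- A generalized transversal is a countable disjoint union of Borel partial graphs. -/
theorem exists_partition {B : Set (T × P)} (hB : IsGeneralizedTransversal B) :
    ∃ D : ℕ → Set (T × P), (∀ n, MeasurableSet (D n)) ∧
      Pairwise (fun m n => Disjoint (D m) (D n)) ∧ (⋃ n, D n) = B ∧ ∀ n, InjOn Prod.fst (D n) := by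
  have : StandardBorelSpace B := hB.1.standardBorel
  have hg : Measurable fun x : B => (x : T × P).1 := measurable_fst.comp measurable_subtype_coe
  obtain ⟨D, h1, h2, h3, h4⟩ := hg.exists_partition_injOn_of_countable_fibres fun t => by
    refine ((hB.2 t).preimage Subtype.val_injective).mono ?_
    rintro x rfl
    exact ⟨x.2, rfl, trivial⟩
  refine ⟨fun n => Subtype.val '' D n, fun n => hB.1.subtype_image (h1 n), fun m n hmn => ?_, ?_, ?_⟩
  · exact (disjoint_image_iff Subtype.val_injective).2 (h2 hmn)
  · rw [← image_iUnion, h3, image_univ, Subtype.range_coe]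
  · rintro n _ ⟨x, hx, rfl⟩ _ ⟨y, hy, rfl⟩ h
    rw [h4 n hx hy h]

theorem measurableSet_image_fst {B : Set (T × P)} (hB : IsGeneralizedTransversal B) :
    MeasurableSet (Prod.fst '' B) := by
  obtain ⟨D, h1, -, rfl, h4⟩ := hB.exists_partition
  rw [image_iUnion]
  exact .iUnion fun n => (h1 n).image_of_measurable_injOn measurable_fst (h4 n)

end IsGeneralizedTransversal

/-- A Borel partial graph over `T` is isomorphic to a horizontal Borel set, along the leaves. -/
theorem exists_measurableEquiv_prod_singleton {T P : Type*} [MeasurableSpace T]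
    [StandardBorelSpace T] [MeasurableSpace P] [StandardBorelSpace P] {D : Set (T × P)}
    (hD : MeasurableSet D) (hinj : InjOn Prod.fst D) (p : P) :
    ∃ γ : D ≃ᵐ ((Prod.fst '' D) ×ˢ {p} : Set (T × P)),
      ∀ x : D, (γ x : T × P).1 = (x : T × P).1 := by
  have : StandardBorelSpace D := hD.standardBorel
  let f : D → T × P := fun x => ((x : T × P).1, p)
  have hf : MeasurableEmbedding f := by
    refine Measurable.measurableEmbedding
      ((measurable_fst.comp measurable_subtype_coe).prodMk measurable_const) fun x y h => ?_
    exact Subtype.ext (hinj x.2 y.2 (Prod.ext_iff.1 h).1)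
  have hr : range f = (Prod.fst '' D) ×ˢ {p} := by
    ext ⟨t, q⟩
    simp [f, eq_comm]
  refine ⟨hf.equivRange.trans (MeasurableEquiv.cast (by rw [hr]) (by rw [hr])), fun x => ?_⟩
  have key : ∀ (E : Set (T × P)) (h : range f = E) (h1 : ↥(range f) = ↥E)
      (h2 : HEq (Subtype.instMeasurableSpace : MeasurableSpace (range f))
        (Subtype.instMeasurableSpace : MeasurableSpace E)) (y : range f),
      ((MeasurableEquiv.cast h1 h2 y : E) : T × P) = y := by
    rintro _ rfl _ _ y
    rfl
  rw [MeasurableEquiv.trans_apply, key _ hr, hf.equivRange_apply]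

/-- A transverse invariant measure is determined by its values on horizontal Borel sets. -/
theorem IsTransverseInvariantMeasure.eq_of_eq_prod_singleton {T P : Type*} [MeasurableSpace T]
    [StandardBorelSpace T] [MeasurableSpace P] [StandardBorelSpace P] {ν ν' : Set (T × P) → ℝ≥0∞}
    (hν : IsTransverseInvariantMeasure ν) (hν' : IsTransverseInvariantMeasure ν')
    (h : ∀ A : Set T, MeasurableSet A → ∀ p : P, ν (A ×ˢ {p}) = ν' (A ×ˢ {p}))
    {B : Set (T × P)} (hB : IsGeneralizedTransversal B) : ν B = ν' B := by
  -- A height `p` for the horizontal sets is taken from a point of `B`, as `P` may be empty.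
  rcases B.eq_empty_or_nonempty with rfl | ⟨⟨-, p⟩, -⟩
  · rw [hν.empty, hν'.empty]
  obtain ⟨D, h1, h2, rfl, h4⟩ := hB.exists_partition
  have hD : ∀ n, IsGeneralizedTransversal (D n) := fun n => .of_injOn_fst (h1 n) (h4 n)
  rw [hν.iUnion D hD h2, hν'.iUnion D hD h2]
  refine tsum_congr fun n => ?_
  have hA := (hD n).measurableSet_image_fst
  obtain ⟨γ, hγ⟩ := exists_measurableEquiv_prod_singleton (h1 n) (h4 n) p
  rw [hν.holonomy _ _ (hD n) (.prod_singleton hA p) γ hγ,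
    hν'.holonomy _ _ (hD n) (.prod_singleton hA p) γ hγ, h _ hA]

/-! ### Counting points on plaques -/

section PlaqueCount

variable {T P : Type*}

theorem plaqueCount_empty (t : T) : plaqueCount (∅ : Set (T × P)) t = 0 := by
  simp [plaqueCount]

theorem plaqueCount_mono {B B' : Set (T × P)} (h : B ⊆ B') (t : T) :
    plaqueCount B t ≤ plaqueCount B' t := by
  unfold plaqueCount
  gcongr

theorem plaqueCount_eq_count [MeasurableSpace T] [MeasurableSpace P] [MeasurableSingletonClass T]
    [MeasurableSingletonClass P] {B : Set (T × P)} (hB : MeasurableSet B) (t : T) :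
    plaqueCount B t = Measure.count (B ∩ ({t} ×ˢ univ)) := by
  rw [plaqueCount, Measure.count_apply (hB.inter ((measurableSet_singleton t).prod .univ))]

theorem plaqueCount_iUnion [MeasurableSpace T] [MeasurableSpace P] [MeasurableSingletonClass T]
    [MeasurableSingletonClass P] {B : ℕ → Set (T × P)} (hB : ∀ n, MeasurableSet (B n))
    (hd : Pairwise (fun m n => Disjoint (B m) (B n))) (t : T) :
    plaqueCount (⋃ n, B n) t = ∑' n, plaqueCount (B n) t := by
  simp_rw [plaqueCount_eq_count (.iUnion hB), plaqueCount_eq_count (hB _), iUnion_inter]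
  exact measure_iUnion (fun m n hmn => (hd hmn).mono inter_subset_left inter_subset_left)
    fun n => (hB n).inter ((measurableSet_singleton t).prod .univ)

theorem plaqueCount_prod_singleton (A : Set T) (p : P) (t : T) :
    plaqueCount (A ×ˢ {p}) t = A.indicator 1 t := by
  by_cases ht : t ∈ A
  · have : A ×ˢ {p} ∩ {t} ×ˢ univ = {(t, p)} := by
      ext ⟨s, q⟩
      simp only [mem_inter_iff, mem_prod, mem_singleton_iff, mem_univ, and_true, Prod.mk.injEq]
      constructor
      · tauto
      · rintro ⟨rfl, rfl⟩
        tauto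
    simp [plaqueCount, this, ht]
  · have : A ×ˢ {p} ∩ {t} ×ˢ univ = ∅ := by
      ext ⟨s, q⟩
      simp only [mem_inter_iff, mem_prod, mem_singleton_iff, mem_univ, and_true,
        mem_empty_iff_false, iff_false]
      rintro ⟨⟨h, -⟩, rfl⟩
      exact ht h
    simp [plaqueCount, this, ht]

theorem plaqueCount_congr_of_equiv {B B' : Set (T × P)} (γ : B ≃ B')
    (hγ : ∀ x : B, (γ x : T × P).1 = (x : T × P).1) (t : T) :
    plaqueCount B t = plaqueCount B' t := by
  have key : ∀ {C C' : Set (T × P)} (δ : C ≃ C'), (∀ x : C, (δ x : T × P).1 = (x : T × P).1) →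
      plaqueCount C t ≤ plaqueCount C' t := by
    intro C C' δ hδ
    refine ENat.toENNReal_le.2 ?_
    classical
    rw [← Set.InjOn.encard_image (f := fun x => if h : x ∈ C then (δ ⟨x, h⟩ : T × P) else x)]
    · refine encard_le_encard ?_
      rintro _ ⟨x, hx, rfl⟩
      simp only [hx.1, dif_pos]
      refine ⟨(δ ⟨x, hx.1⟩).2, ?_, trivial⟩
      rw [hδ]
      exact hx.2.1
    · intro x hx y hy h
      simpa [hx.1, hy.1, Subtype.val_inj] using h
  refine le_antisymm (key γ hγ) (key γ.symm fun x => ?_)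
  rw [← hγ, Equiv.apply_symm_apply]

end PlaqueCount

/-- The number of points of a plaque is the largest number of members of a finite disjoint family
of basic open sets which meet the plaque. -/
theorem plaqueCount_eq_iSup {T P ι : Type*} [TopologicalSpace T] [TopologicalSpace P] [T2Space T]
    [T2Space P] {b : ι → Set (T × P)} (hb : TopologicalSpace.IsTopologicalBasis (range b))
    (B : Set (T × P)) (t : T) :
    plaqueCount B t = ⨆ F : {F : Finset ι // (F : Set ι).PairwiseDisjoint b},
      ∑ i ∈ F.1, (Prod.fst '' (B ∩ b i)).indicator (1 : T → ℝ≥0∞) t := by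
  classical
  refine le_antisymm ?_ (iSup_le fun F => ?_)
  · have key : ∀ S : Finset (T × P), (S : Set (T × P)) ⊆ B ∩ ({t} ×ˢ univ) → (S.card : ℝ≥0∞) ≤
        ⨆ F : {F : Finset ι // (F : Set ι).PairwiseDisjoint b},
          ∑ i ∈ F.1, (Prod.fst '' (B ∩ b i)).indicator (1 : T → ℝ≥0∞) t := by
      intro S hS
      -- Finitely many points on the plaque have disjoint basic neighbourhoods, a family whose sum
      -- at `t` is the number of points.
      obtain ⟨U, hU, hUd⟩ := S.finite_toSet.t2_separation
      have hc : ∀ x, ∃ i, x ∈ b i ∧ b i ⊆ U x := by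
        intro x
        obtain ⟨_, ⟨i, rfl⟩, h⟩ := hb.exists_subset_of_mem_open (hU x).1 (hU x).2
        exact ⟨i, h⟩
      choose c hxc hcU using hc
      have hcd : ∀ x ∈ S, ∀ y ∈ S, x ≠ y → Disjoint (b (c x)) (b (c y)) := fun x hx y hy hxy =>
        (hUd hx hy hxy).mono (hcU x) (hcU y)
      have hcinj : InjOn c S := by
        intro x hx y hy hxy
        by_contra hne
        exact disjoint_left.1 (hcd x hx y hy hne) (hxc x) (hxy ▸ hxc x)
      refine le_trans (le_of_eq ?_) (le_iSup _ ⟨S.image c, ?_⟩)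
      · rw [Finset.sum_image hcinj, Finset.sum_congr rfl fun x hx => indicator_of_mem
          (show t ∈ Prod.fst '' (B ∩ b (c x)) from ⟨x, ⟨(hS hx).1, hxc x⟩, (hS hx).2.1⟩) 1]
        simp
      · intro i hi j hj hij
        obtain ⟨x, hx, rfl⟩ := Finset.mem_image.1 hi
        obtain ⟨y, hy, rfl⟩ := Finset.mem_image.1 hj
        exact hcd x hx y hy fun h => hij (h ▸ rfl)
    by_cases hfin : (B ∩ ({t} ×ˢ univ)).Finite
    · have := key hfin.toFinset (by simp)
      rwa [plaqueCount, hfin.encard_eq_coe_toFinset_card, ENat.toENNReal_coe]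
    · rw [ENNReal.eq_top_of_forall_nnreal_le (x := ⨆ F : _, _) fun r => ?_]
      · exact le_top
      obtain ⟨n, hn⟩ := exists_nat_ge r
      obtain ⟨S, hS, hcard⟩ := (show (B ∩ ({t} ×ˢ univ)).Infinite from hfin).exists_subset_card_eq n
      refine le_trans ?_ (key S hS)
      rw [hcard]
      exact_mod_cast hn
  -- Conversely, disjoint sets meeting the plaque contain distinct points of it.
  · set G := F.1.filter fun i => t ∈ Prod.fst '' (B ∩ b i) with hG
    have hsum : ∑ i ∈ F.1, (Prod.fst '' (B ∩ b i)).indicator (1 : T → ℝ≥0∞) t = G.card := by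
      simp [indicator_apply, hG]
    have hw : ∀ i : G, ∃ w ∈ B ∩ b i, w.1 = t := fun i => (Finset.mem_filter.1 i.2).2
    choose w hw hwt using hw
    have hwinj : Function.Injective w := by
      intro i j hij
      by_contra hne
      exact disjoint_left.1 (F.2 (Finset.mem_filter.1 i.2).1 (Finset.mem_filter.1 j.2).1
        fun h => hne (Subtype.ext h)) (hw i).2 (hij ▸ (hw j).2)
    have hcard : (G.card : ℕ∞) = (range w).encard := by
      rw [← image_univ, hwinj.encard_image, encard_univ, ENat.card_eq_coe_fintype_card,
        Fintype.card_coe]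
    rw [hsum, plaqueCount, ← ENat.toENNReal_coe, ENat.toENNReal_le, hcard]
    refine encard_le_encard ?_
    rintro _ ⟨i, rfl⟩
    exact ⟨(hw i).1, hwt i, trivial⟩

/-- A countable basis has countably many finite subfamilies, and the projections occurring in
`plaqueCount_eq_iSup` are exactly of the kind controlled by `projClass`. -/
theorem aemeasurable_plaqueCount {T P : Type*} [MeasurableSpace T]
    [TopologicalSpace T] [T2Space T] [SecondCountableTopology T]
    [TopologicalSpace P] [T2Space P] [SecondCountableTopology P] [MeasurableSpace P]
    {Λ : Measure T} {B : Set (T × P)} (hB : B ∈ projClass Λ) : AEMeasurable (plaqueCount B) Λ := by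
  let b : TopologicalSpace.countableBasis (T × P) → Set (T × P) := Subtype.val
  have hb : TopologicalSpace.IsTopologicalBasis (range b) := by
    simpa [b] using TopologicalSpace.isBasis_countableBasis (T × P)
  rw [funext fun t => plaqueCount_eq_iSup hb B t]
  refine AEMeasurable.iSup fun F => Finset.aemeasurable_fun_sum _ fun i _ => ?_
  exact aemeasurable_const.indicator₀ (hB.2 _ (hb.isOpen (mem_range_self i)))

/-! ### The projection class and countable additivity -/

section ProjClassBasic

variable {T P : Type*} [MeasurableSpace T] [TopologicalSpace T] [TopologicalSpace P]
  [MeasurableSpace P] {Λ : Measure T}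

theorem iUnion_mem_projClass {B : ℕ → Set (T × P)} (hB : ∀ n, B n ∈ projClass Λ) :
    (⋃ n, B n) ∈ projClass Λ :=
  ⟨.iUnion fun n => (hB n).1, fun U hU => by
    rw [iUnion_inter, image_iUnion]
    exact .iUnion fun n => (hB n).2 U hU⟩

theorem extendedMeasure_of_mem {B : Set (T × P)} (hB : B ∈ projClass Λ) :
    extendedMeasure Λ B = ∫⁻ t, plaqueCount B t ∂Λ := if_pos hB

theorem extendedMeasure_of_notMem {B : Set (T × P)} (hB : B ∉ projClass Λ) :
    extendedMeasure Λ B = ∞ := if_neg hB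

end ProjClassBasic

section ProjClass

variable {T P : Type*} [MeasurableSpace T] [TopologicalSpace T] [PolishSpace T]
  [BorelSpace T] [TopologicalSpace P] [PolishSpace P] [MeasurableSpace P]
  [BorelSpace P] {Λ : Measure T}

theorem IsGeneralizedTransversal.mem_projClass {B : Set (T × P)}
    (hB : IsGeneralizedTransversal B) : B ∈ projClass Λ :=
  ⟨hB.1, fun _ hU => (hB.mono inter_subset_left
    (hB.1.inter hU.measurableSet)).measurableSet_image_fst.nullMeasurableSet⟩

/-- Borel subsets of a set of finite extended measure belong to the class `projClass`. -/
theorem mem_projClass_of_subset {B B' : Set (T × P)} (hB : extendedMeasure Λ B ≠ ∞)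
    (hB' : MeasurableSet B') (h : B' ⊆ B) : B' ∈ projClass Λ := by
  have hmem : B ∈ projClass Λ := by
    by_contra hn
    exact hB (extendedMeasure_of_notMem hn)
  rw [extendedMeasure_of_mem hmem] at hB
  have hae := ae_lt_top' (aemeasurable_plaqueCount hmem) hB
  -- A Borel null set outside which the plaques meet `B` finitely often. Off `N` the set `B' ∩ U` is
  -- a transversal with Borel projection; over `N` its projection is null.
  set N := toMeasurable Λ {t | ¬ plaqueCount B t < ∞} with hN
  have hN0 : Λ N = 0 := by rw [hN, measure_toMeasurable]; exact hae
  refine ⟨hB', fun U hU => ?_⟩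
  have hV : MeasurableSet ((B' ∩ U) \ (Prod.fst ⁻¹' N)) :=
    (hB'.inter hU.measurableSet).diff (measurable_fst (measurableSet_toMeasurable _ _))
  have htrans : IsGeneralizedTransversal ((B' ∩ U) \ (Prod.fst ⁻¹' N)) := by
    refine ⟨hV, fun t => ?_⟩
    by_cases ht : t ∈ N
    · convert countable_empty
      ext ⟨s, q⟩
      simp only [mem_inter_iff, mem_sdiff, mem_preimage, mem_prod, mem_singleton_iff, mem_univ,
        and_true, mem_empty_iff_false, iff_false]
      rintro ⟨⟨-, h⟩, rfl⟩
      exact h ht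
    · have hlt : plaqueCount B t < ∞ := by
        by_contra hlt
        exact ht (subset_toMeasurable _ _ hlt)
      rw [plaqueCount, ENat.toENNReal_lt_top, encard_lt_top_iff] at hlt
      exact (hlt.subset (inter_subset_inter_left _
        (sdiff_subset.trans (inter_subset_left.trans h)))).countable
  have hrest : NullMeasurableSet (Prod.fst '' ((B' ∩ U) ∩ (Prod.fst ⁻¹' N))) Λ :=
    .of_null (measure_mono_null (by rintro _ ⟨x, hx, rfl⟩; exact hx.2) hN0)
  rw [← sdiff_union_inter (B' ∩ U) (Prod.fst ⁻¹' N), image_union]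
  exact htrans.measurableSet_image_fst.nullMeasurableSet.union hrest

theorem extendedMeasure_empty : extendedMeasure Λ (∅ : Set (T × P)) = 0 := by
  rw [extendedMeasure_of_mem (IsGeneralizedTransversal.mem_projClass ⟨.empty, by simp⟩)]
  simp [plaqueCount_empty]

theorem extendedMeasure_mono {B B' : Set (T × P)} (hB' : MeasurableSet B') (h : B' ⊆ B) :
    extendedMeasure Λ B' ≤ extendedMeasure Λ B := by
  by_cases htop : extendedMeasure Λ B = ∞
  · simp [htop]
  have hmem : B ∈ projClass Λ := mem_projClass_of_subset htop
    (by by_contra hn; exact htop (extendedMeasure_of_notMem fun hB => hn hB.1)) Subset.rfl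
  rw [extendedMeasure_of_mem hmem, extendedMeasure_of_mem (mem_projClass_of_subset htop hB' h)]
  exact lintegral_mono fun t => plaqueCount_mono h t

/-- Within the class this is monotone convergence. If some `B n` lies outside, both sides are `∞`:
by monotonicity, no set of finite value contains `B n`. -/
theorem extendedMeasure_iUnion {B : ℕ → Set (T × P)} (hB : ∀ n, MeasurableSet (B n))
    (hd : Pairwise (fun m n => Disjoint (B m) (B n))) :
    extendedMeasure Λ (⋃ n, B n) = ∑' n, extendedMeasure Λ (B n) := by
  by_cases hall : ∀ n, B n ∈ projClass Λ
  · rw [extendedMeasure_of_mem (iUnion_mem_projClass hall)]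
    simp_rw [plaqueCount_iUnion hB hd]
    rw [lintegral_tsum fun n => aemeasurable_plaqueCount (hall n)]
    exact tsum_congr fun n => (extendedMeasure_of_mem (hall n)).symm
  · push Not at hall
    obtain ⟨n, hn⟩ := hall
    have htop := extendedMeasure_of_notMem hn
    rw [ENNReal.tsum_eq_top_of_eq_top ⟨n, htop⟩, ← top_le_iff, ← htop]
    exact extendedMeasure_mono (hB n) (subset_iUnion B n)

theorem extendedMeasure_prod_singleton {A : Set T} (hA : MeasurableSet A) (p : P) :
    extendedMeasure Λ (A ×ˢ {p}) = Λ A := by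
  rw [extendedMeasure_of_mem (IsGeneralizedTransversal.prod_singleton hA p).mem_projClass]
  simp_rw [plaqueCount_prod_singleton]
  exact lintegral_indicator_one hA

theorem isTransverseInvariantMeasure_extendedMeasure (Λ : Measure T) :
    IsTransverseInvariantMeasure (extendedMeasure (P := P) Λ) where
  empty := extendedMeasure_empty
  iUnion B hB hd := extendedMeasure_iUnion (fun n => (hB n).1) hd
  holonomy B B' hB hB' γ hγ := by
    rw [extendedMeasure_of_mem hB.mem_projClass, extendedMeasure_of_mem hB'.mem_projClass]
    exact lintegral_congr fun t => plaqueCount_congr_of_equiv γ.toEquiv hγ t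

end ProjClass

theorem propositionp {T P : Type*}
    [MeasurableSpace T] [StandardBorelSpace T]
    [TopologicalSpace T] [PolishSpace T] [BorelSpace T]
    [TopologicalSpace P] [PolishSpace P] [MeasurableSpace P] [BorelSpace P]
    (Λ : Measure T) :
    -- the integral defining the extension makes sense on the class
    (∀ B ∈ projClass (P := P) Λ, AEMeasurable (plaqueCount B) Λ) ∧
    -- the extension is a measure on the Borel sets of `T × P`
    (∃ μ : Measure (T × P), ∀ B : Set (T × P), MeasurableSet B → μ B = extendedMeasure Λ B) ∧
    -- it extends `Λ`, seen on the transversals `T × {p}`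
    (∀ A : Set T, MeasurableSet A → ∀ p : P, extendedMeasure Λ (A ×ˢ {p}) = Λ A) ∧
    -- on generalized transversals it is the transverse invariant measure induced by `Λ`
    IsTransverseInvariantMeasure (extendedMeasure (P := P) Λ) ∧
    (∀ ν : Set (T × P) → ℝ≥0∞, IsTransverseInvariantMeasure ν →
      (∀ A : Set T, MeasurableSet A → ∀ p : P, ν (A ×ˢ {p}) = Λ A) →
      ∀ B : Set (T × P), IsGeneralizedTransversal B → extendedMeasure Λ B = ν B) := by
  refine ⟨fun B hB => aemeasurable_plaqueCount hB, ?_,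
    fun A hA p => extendedMeasure_prod_singleton hA p,
    isTransverseInvariantMeasure_extendedMeasure Λ, fun ν hν hνΛ B hB => ?_⟩
  · exact ⟨Measure.ofMeasurable (fun B _ => extendedMeasure Λ B) extendedMeasure_empty
      fun B hB hd => extendedMeasure_iUnion hB hd, fun B hB => Measure.ofMeasurable_apply B hB⟩
  · refine (isTransverseInvariantMeasure_extendedMeasure Λ).eq_of_eq_prod_singleton hν
      (fun A hA p => ?_) hB
    rw [extendedMeasure_prod_singleton hA p, hνΛ A hA p]
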